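/- A continuum is a nonempty compact connected metric space, and a subcontinuum of a continuum $X$ is a nonempty compact connected subset of $X$. A continuum $X$ is hereditarily unicoherent if $A\cap B$ is connected (possibly empty) for every two subcontinua $A$ and $B$ of $X$. For $x\in X$, the meager composant of $x$ is $$M_x=\bigcup\{L\subset X : L\text{ is a nowhere dense subcontinuum of }X\text{ and }x\in L\},$$ and $\mathcal M_X=\{M_x : x\in X\}$ is the set of all meager composants of $X$. **Theorem.** If $X$ is a hereditarily unicoherent continuum, then $|\mathcal M_X|\in\{1,2^{\aleph_0}\}$; that is, $X$ has either exactly one or exactly $2^{\aleph_0}$ meager composants. -/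

import Mathlib

/-- A subcontinuum of a space: a nonempty compact connected subset (one-point sets are allowed). -/
def IsSubcontinuum {X : Type*} [TopologicalSpace X] (L : Set X) : Prop :=
  IsCompact L ∧ IsConnected L

/-- A space is hereditarily unicoherent if the intersection of any two of its subcontinua is
connected, where the empty intersection counts as connected. -/
def HereditarilyUnicoherent (X : Type*) [TopologicalSpace X] : Prop :=
  ∀ A B : Set X, IsSubcontinuum A → IsSubcontinuum B → IsPreconnected (A ∩ B)

/-- The meager composant of `x`: the union of all nowhere dense subcontinua that contain `x`. -/
def meagerComposant {X : Type*} [TopologicalSpace X] (x : X) : Set X :=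
  ⋃₀ {L : Set X | IsSubcontinuum L ∧ IsNowhereDense L ∧ x ∈ L}

/-- The collection of all meager composants of a space. -/
def meagerComposants (X : Type*) [TopologicalSpace X] : Set (Set X) :=
  {M : Set X | ∃ x : X, M = meagerComposant x}

/-! If `y` is outside the meager composant of `x`, the least continuum `K` joining them, which
hereditary unicoherence provides, is not nowhere dense; let `U` be its interior. It suffices that
lying in a common nowhere dense continuum is a meagre relation on `U`: Mycielski's theorem then
yields a Cantor set of points with distinct meager composants, and `X` has at most continuum many
points.

For meagreness, a nowhere dense continuum misses a basic set `B` inside every open set. Off the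
boundaries of the countably many closed relations "in one component of `Bᶜ`", nearby pairs are
joined in `Bᶜ` too. If this happened on a somewhere dense subset of `U ×ˢ U`, Baire category would
give a point `p` with `SpreadsOver p Q` for some nonempty open `Q ⊆ U`. Minimality of joining
continua forbids that (`not_spreadsOver_of_subset_joiningContinuum`). -/

open Set Topology

/-- The intersection of all subcontinua that contain both `x` and `y`. -/
def joiningContinuum {X : Type*} [TopologicalSpace X] (x y : X) : Set X :=
  ⋂₀ {L : Set X | IsSubcontinuum L ∧ x ∈ L ∧ y ∈ L}

/-! ### Least continua joining two points. -/

section JoiningContinuum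

variable {X : Type*} [TopologicalSpace X]

theorem mem_joiningContinuum_left (x y : X) : x ∈ joiningContinuum x y :=
  fun _ hL => hL.2.1

theorem mem_joiningContinuum_right (x y : X) : y ∈ joiningContinuum x y :=
  fun _ hL => hL.2.2

theorem joiningContinuum_subset {x y : X} {L : Set X} (hL : IsSubcontinuum L) (hx : x ∈ L)
    (hy : y ∈ L) : joiningContinuum x y ⊆ L :=
  sInter_subset_of_mem ⟨hL, hx, hy⟩

/-- The intersection of a nonempty downward directed family of compact preconnected sets in a
Hausdorff space is preconnected. -/
theorem isPreconnected_iInter_of_directed [T2Space X] {ι : Type*} [Nonempty ι] {V : ι → Set X}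
    (hdir : Directed (· ⊇ ·) V) (hcomp : ∀ i, IsCompact (V i))
    (hconn : ∀ i, IsPreconnected (V i)) : IsPreconnected (⋂ i, V i) := by
  have hK : IsCompact (⋂ i, V i) :=
    (hcomp (Classical.arbitrary ι)).of_isClosed_subset
      (isClosed_iInter fun i => (hcomp i).isClosed) (iInter_subset _ _)
  rw [isPreconnected_iff_subset_of_fully_disjoint_closed hK.isClosed]
  intro u v hu hv huv hdis
  obtain ⟨u', v', hu', hv', huu, hvv, hd⟩ := SeparatedNhds.of_isCompact_isCompact
    (hK.inter_right hu) (hK.inter_right hv)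
    (hdis.mono inter_subset_right inter_subset_right)
  have hsub : (⋂ i, V i) ⊆ u' ∪ v' := fun z hz =>
    (huv hz).imp (fun h => huu ⟨hz, h⟩) (fun h => hvv ⟨hz, h⟩)
  obtain ⟨i, hi⟩ := exists_subset_nhds_of_isCompact' hdir hcomp (fun i => (hcomp i).isClosed)
    (U := u' ∪ v') (fun x hx => (hu'.union hv').mem_nhds (hsub hx))
  rcases (hconn i).subset_or_subset hu' hv' hd hi with h | h
  · left
    intro z hz
    refine (huv hz).resolve_right fun hzv => ?_
    exact disjoint_left.1 hd (h (mem_iInter.1 hz i)) (hvv ⟨hz, hzv⟩)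
  · right
    intro z hz
    refine (huv hz).resolve_left fun hzu => ?_
    exact disjoint_left.1 hd (huu ⟨hz, hzu⟩) (h (mem_iInter.1 hz i))

theorem HereditarilyUnicoherent.isSubcontinuum_inter [T2Space X] (hX : HereditarilyUnicoherent X)
    {A B : Set X} (hA : IsSubcontinuum A) (hB : IsSubcontinuum B) (h : (A ∩ B).Nonempty) :
    IsSubcontinuum (A ∩ B) :=
  ⟨hA.1.inter hB.1, h, hX A B hA hB⟩

theorem IsSubcontinuum.union {A B : Set X} (hA : IsSubcontinuum A) (hB : IsSubcontinuum B)
    (h : (A ∩ B).Nonempty) : IsSubcontinuum (A ∪ B) :=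
  ⟨hA.1.union hB.1, hA.2.union h hB.2⟩

/-- Unicoherence makes the family of continua through both points downward directed. -/
theorem HereditarilyUnicoherent.isSubcontinuum_joiningContinuum [T2Space X] [CompactSpace X]
    [ConnectedSpace X] (hX : HereditarilyUnicoherent X) (x y : X) :
    IsSubcontinuum (joiningContinuum x y) := by
  let S : Set (Set X) := {L : Set X | IsSubcontinuum L ∧ x ∈ L ∧ y ∈ L}
  have hne : Nonempty S := ⟨⟨univ, ⟨isCompact_univ, isConnected_univ⟩, mem_univ x, mem_univ y⟩⟩
  have hdir : Directed (· ⊇ ·) (fun L : S => (L : Set X)) := by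
    rintro ⟨A, hA, hxA, hyA⟩ ⟨B, hB, hxB, hyB⟩
    exact ⟨⟨A ∩ B, hX.isSubcontinuum_inter hA hB ⟨x, hxA, hxB⟩, ⟨hxA, hxB⟩, ⟨hyA, hyB⟩⟩,
      inter_subset_left, inter_subset_right⟩
  have heq : joiningContinuum x y = ⋂ L : S, (L : Set X) := sInter_eq_iInter
  refine ⟨?_, ⟨x, mem_joiningContinuum_left x y⟩, ?_⟩
  · rw [heq]
    exact (isClosed_iInter fun L : S => L.2.1.1.isClosed).isCompact
  · rw [heq]
    exact isPreconnected_iInter_of_directed hdir (fun L => L.2.1.1)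
      (fun L => L.2.1.2.isPreconnected)

end JoiningContinuum

/-! ### Complements of subcontinua in an irreducible continuum. -/

section Complement

variable {X : Type*} [TopologicalSpace X]

/-- Removing one side of a separation of `K \ C` from the connected set `K` leaves a connected
set, if `C` is connected. -/
theorem isPreconnected_inter_union_compl {K C u v : Set X} (hK : IsPreconnected K)
    (hKc : IsClosed K) (hC : IsPreconnected C) (hCc : IsClosed C) (hCK : C ⊆ K) (hu : IsOpen u)
    (hv : IsOpen v) (hcov : K \ C ⊆ u ∪ v) (huv : ∀ z ∈ K \ C, z ∈ u → z ∉ v) :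
    IsPreconnected (K ∩ (C ∪ vᶜ)) := by
  have hM : IsClosed (K ∩ (C ∪ vᶜ)) := hKc.inter (hCc.union hv.isClosed_compl)
  have hN : IsClosed (K ∩ (C ∪ uᶜ)) := hKc.inter (hCc.union hu.isClosed_compl)
  have key : ∀ A B : Set X, IsClosed A → IsClosed B → K ∩ (C ∪ vᶜ) ⊆ A ∪ B → Disjoint A B →
      C ⊆ A → K ∩ (C ∪ vᶜ) ⊆ A ∨ K ∩ (C ∪ vᶜ) ⊆ B := by
    intro A B hA hB hAB hdis hCA
    rw [isPreconnected_iff_subset_of_fully_disjoint_closed hKc] at hK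
    have hd : ∀ z ∈ K ∩ (C ∪ vᶜ), z ∈ B → z ∉ K ∩ (C ∪ uᶜ) := by
      rintro z ⟨hzK, hz⟩ hzB ⟨-, hz'⟩
      have hzC : z ∉ C := fun h => disjoint_left.1 hdis (hCA h) hzB
      exact (hcov ⟨hzK, hzC⟩).elim (hz'.resolve_left hzC) (hz.resolve_left hzC)
    -- The part in `B` misses `C`, so it is separated from all the rest of `K`, including the
    -- removed side.
    have hcover : K ⊆ (K ∩ (C ∪ vᶜ) ∩ B) ∪ ((K ∩ (C ∪ vᶜ) ∩ A) ∪ (K ∩ (C ∪ uᶜ))) := by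
      intro z hzK
      by_cases hzC : z ∈ C
      · exact Or.inr (Or.inl ⟨⟨hzK, Or.inl hzC⟩, hCA hzC⟩)
      · by_cases hzu : z ∈ u
        · have hz : z ∈ K ∩ (C ∪ vᶜ) := ⟨hzK, Or.inr (huv z ⟨hzK, hzC⟩ hzu)⟩
          exact (hAB hz).elim (fun h => Or.inr (Or.inl ⟨hz, h⟩)) (fun h => Or.inl ⟨hz, h⟩)
        · exact Or.inr (Or.inr ⟨hzK, Or.inr hzu⟩)
    have hdisj : Disjoint (K ∩ (C ∪ vᶜ) ∩ B) ((K ∩ (C ∪ vᶜ) ∩ A) ∪ (K ∩ (C ∪ uᶜ))) := by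
      refine disjoint_left.2 ?_
      rintro z ⟨hz, hzB⟩ (h | h)
      · exact disjoint_left.1 hdis h.2 hzB
      · exact hd z hz hzB h
    rcases hK _ _ (hM.inter hB) ((hM.inter hA).union hN) hcover hdisj with h | h
    · exact Or.inr fun z hz => (h hz.1).2
    · left
      intro z hz
      refine (hAB hz).resolve_right fun hzB => ?_
      rcases h hz.1 with h' | h'
      · exact disjoint_left.1 hdis h'.2 hzB
      · exact hd z hz hzB h'
  have hCM : C ⊆ K ∩ (C ∪ vᶜ) := fun z hz => ⟨hCK hz, Or.inl hz⟩
  rw [isPreconnected_iff_subset_of_fully_disjoint_closed hM]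
  intro A B hA hB hAB hdis
  rw [isPreconnected_iff_subset_of_fully_disjoint_closed hCc] at hC
  rcases hC A B hA hB (hCM.trans hAB) hdis with h | h
  · exact key A B hA hB hAB hdis h
  · exact (key B A hB hA (hAB.trans (union_comm A B).subset) hdis.symm h).symm

/-- In a continuum `joiningContinuum p z`, the complement of a subcontinuum that contains `p` is
connected. -/
theorem isPreconnected_joiningContinuum_diff [T2Space X] {p z : X} {C : Set X}
    (hK : IsSubcontinuum (joiningContinuum p z)) (hC : IsSubcontinuum C)
    (hCK : C ⊆ joiningContinuum p z) (hp : p ∈ C) :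
    IsPreconnected (joiningContinuum p z \ C) := by
  set K := joiningContinuum p z with hKdef
  by_cases hzC : z ∈ C
  · rw [sdiff_eq_empty.2 (joiningContinuum_subset hC hp hzC)]
    exact isPreconnected_empty
  have key : ∀ u v : Set X, IsOpen u → IsOpen v → K \ C ⊆ u ∪ v →
      (∀ w ∈ K \ C, w ∈ u → w ∉ v) → z ∈ u → ¬ ((K \ C) ∩ v).Nonempty := by
    rintro u v hu hv hcov huv hzu ⟨w, hw, hwv⟩
    have hM := isPreconnected_inter_union_compl hK.2.isPreconnected hK.1.isClosed
      hC.2.isPreconnected hC.1.isClosed hCK hu hv hcov huv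
    have hzK : z ∈ K := mem_joiningContinuum_right p z
    have hpM : p ∈ K ∩ (C ∪ vᶜ) := ⟨mem_joiningContinuum_left p z, Or.inl hp⟩
    -- Dropping the side without `z` leaves a continuum through `p` and `z`, so by minimality
    -- nothing was dropped.
    have hsub : K ⊆ K ∩ (C ∪ vᶜ) := joiningContinuum_subset
      ⟨hK.1.inter_right (hC.1.isClosed.union hv.isClosed_compl), ⟨p, hpM⟩, hM⟩ hpM
      ⟨hzK, Or.inr (huv z ⟨hzK, hzC⟩ hzu)⟩
    exact ((hsub hw.1).2.resolve_left hw.2) hwv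
  intro u v hu hv hcov hnu hnv
  by_contra hemp
  have huv : ∀ w ∈ K \ C, w ∈ u → w ∉ v := fun w hw hwu hwv => hemp ⟨w, hw, hwu, hwv⟩
  rcases hcov ⟨mem_joiningContinuum_right p z, hzC⟩ with hz | hz
  · exact key u v hu hv hcov huv hz hnv
  · exact key v u hv hu (by rwa [union_comm]) (fun w hw hwv hwu => huv w hw hwu hwv) hz hnu

end Complement

/-! ### Points cannot spread over an open part of a joining continuum. -/

section Spreading

variable {X : Type*} [TopologicalSpace X]

/-- `SpreadsOver p Q`: subcontinua through `p` can have interior points in any prescribed nonempty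
open subset of `Q` while failing to cover any prescribed nonempty open set. -/
def SpreadsOver (p : X) (Q : Set X) : Prop :=
  ∀ B Q' : Set X, IsOpen B → B.Nonempty → IsOpen Q' → Q'.Nonempty → Q' ⊆ Q →
    ∃ C : Set X, IsSubcontinuum C ∧ p ∈ C ∧ ¬ B ⊆ C ∧ (interior C ∩ Q').Nonempty

theorem SpreadsOver.mono {p : X} {Q R : Set X} (h : SpreadsOver p Q) (hR : R ⊆ Q) :
    SpreadsOver p R :=
  fun B Q' hB hBn hQ hQn hQR => h B Q' hB hBn hQ hQn (hQR.trans hR)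

variable [T2Space X] [CompactSpace X] [ConnectedSpace X] [Nontrivial X]

/-- Spreading gives `C₁` missing part of `Q`, then `C₂` that reaches this missed part yet omits an
interior point `w` of `C₁`. Following `C₂` and then the closure of what lies beyond `C₁` joins `p`
to `z` without `w`, against minimality. -/
theorem HereditarilyUnicoherent.not_spreadsOver_of_subset_joiningContinuum_left
    (hX : HereditarilyUnicoherent X) {p z : X} {Q : Set X} (hQ : IsOpen Q) (hQn : Q.Nonempty)
    (hQK : Q ⊆ joiningContinuum p z) : ¬ SpreadsOver p Q := by
  intro h
  have hK := hX.isSubcontinuum_joiningContinuum p z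
  obtain ⟨a, haQ, b, hbQ, hab⟩ :=
    (infinite_of_mem_nhds hQn.some (hQ.mem_nhds hQn.some_mem)).nontrivial
  obtain ⟨U₁, U₂, hU₁, hU₂, haU, hbU, hdis⟩ := t2_separation hab
  obtain ⟨C₁, hC₁, hpC₁, hB₁, hi₁⟩ := h (U₁ ∩ Q) (U₂ ∩ Q) (hU₁.inter hQ) ⟨a, haU, haQ⟩
    (hU₂.inter hQ) ⟨b, hbU, hbQ⟩ inter_subset_right
  obtain ⟨c, hcU, hcC⟩ := not_subset.1 hB₁
  obtain ⟨C₂, hC₂, hpC₂, hB₂, r, hrC₂, hrU, hrC₁⟩ := h (interior C₁ ∩ (U₂ ∩ Q))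
    ((U₁ ∩ Q) \ C₁) (isOpen_interior.inter (hU₂.inter hQ)) hi₁
    ((hU₁.inter hQ).sdiff hC₁.1.isClosed) ⟨c, hcU, hcC⟩ (fun _ hz => hz.1.2)
  obtain ⟨w, ⟨hwi, hwU⟩, hwC₂⟩ := not_subset.1 hB₂
  have hCK : IsSubcontinuum (C₁ ∩ joiningContinuum p z) :=
    hX.isSubcontinuum_inter hC₁ hK ⟨p, hpC₁, mem_joiningContinuum_left p z⟩
  have hpre := isPreconnected_joiningContinuum_diff hK hCK inter_subset_right
    ⟨hpC₁, mem_joiningContinuum_left p z⟩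
  have hrK : r ∈ joiningContinuum p z \ (C₁ ∩ joiningContinuum p z) :=
    ⟨hQK hrU.2, fun hr => hrC₁ hr.1⟩
  have hzC₁ : z ∉ C₁ := fun hz => hcC (joiningContinuum_subset hC₁ hpC₁ hz (hQK hcU.2))
  have hD : IsSubcontinuum (closure (joiningContinuum p z \ (C₁ ∩ joiningContinuum p z))) :=
    ⟨isClosed_closure.isCompact, ⟨r, subset_closure hrK⟩, hpre.closure⟩
  have hsub := joiningContinuum_subset
    (hC₂.union hD ⟨r, interior_subset hrC₂, subset_closure hrK⟩) (Or.inl hpC₂)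
    (Or.inr (subset_closure ⟨mem_joiningContinuum_right p z, fun hz => hzC₁ hz.1⟩))
  have hwD := (hsub (hQK hwU.2)).resolve_left hwC₂
  obtain ⟨t, hti, htK, htC⟩ := mem_closure_iff.1 hwD _ isOpen_interior hwi
  exact htC ⟨interior_subset hti, htK⟩

/-- The continua from `p` to `x` and to `y` together cover `Q`, so one of them contains a nonempty
open part of it. -/
theorem HereditarilyUnicoherent.not_spreadsOver_of_subset_joiningContinuum
    (hX : HereditarilyUnicoherent X) {x y : X} {Q : Set X} (hQ : IsOpen Q) (hQn : Q.Nonempty)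
    (hQK : Q ⊆ joiningContinuum x y) (p : X) : ¬ SpreadsOver p Q := by
  intro h
  have hpx := hX.isSubcontinuum_joiningContinuum p x
  have hpy := hX.isSubcontinuum_joiningContinuum p y
  have hcov : Q ⊆ joiningContinuum p x ∪ joiningContinuum p y := hQK.trans <|
    joiningContinuum_subset (hpx.union hpy
      ⟨p, mem_joiningContinuum_left p x, mem_joiningContinuum_left p y⟩)
      (Or.inl (mem_joiningContinuum_right p x)) (Or.inr (mem_joiningContinuum_right p y))
  by_cases hQx : Q ⊆ joiningContinuum p x
  · exact hX.not_spreadsOver_of_subset_joiningContinuum_left hQ hQn hQx h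
  · exact hX.not_spreadsOver_of_subset_joiningContinuum_left (hQ.sdiff hpx.1.isClosed)
      (sdiff_nonempty.2 hQx) (fun z hz => (hcov hz.1).resolve_left hz.2) (h.mono sdiff_subset)

end Spreading

/-! ### Meagreness of the composant relation. -/

section Meagre

variable {X : Type*} [TopologicalSpace X]

/-- The space of components of a compact Hausdorff space is Hausdorff, so the relation is the
preimage of a closed diagonal. -/
theorem isClosed_setOf_mem_connectedComponentIn [T2Space X] [CompactSpace X] {F : Set X}
    (hF : IsClosed F) : IsClosed {q : X × X | q.2 ∈ connectedComponentIn F q.1} := by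
  have : CompactSpace F := isCompact_iff_compactSpace.1 hF.isCompact
  have hcl : IsClosed {q : F × F | (q.2 : ConnectedComponents F) = (q.1 : ConnectedComponents F)} :=
    isClosed_eq (ConnectedComponents.continuous_coe.comp continuous_snd)
      (ConnectedComponents.continuous_coe.comp continuous_fst)
  have hemb := (hF.isClosedEmbedding_subtypeVal.prodMap hF.isClosedEmbedding_subtypeVal)
  convert hemb.isClosedMap _ hcl using 1
  ext ⟨p, q⟩
  constructor
  · intro h
    have hp : p ∈ F := connectedComponentIn_nonempty_iff.1 ⟨q, h⟩
    rw [mem_ofPred_eq, connectedComponentIn_eq_image hp] at h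
    obtain ⟨r, hr, hrq⟩ := h
    exact ⟨(⟨p, hp⟩, r), ConnectedComponents.coe_eq_coe'.2 hr, Prod.ext rfl hrq⟩
  · rintro ⟨⟨p', q'⟩, h, heq⟩
    obtain ⟨rfl, rfl⟩ := Prod.mk.inj heq
    rw [mem_ofPred_eq, connectedComponentIn_eq_image p'.2]
    exact ⟨q', ConnectedComponents.coe_eq_coe'.1 h, rfl⟩

theorem isSubcontinuum_connectedComponentIn [T2Space X] [CompactSpace X] {F : Set X}
    (hF : IsClosed F) {p : X} (hp : p ∈ F) : IsSubcontinuum (connectedComponentIn F p) :=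
  ⟨((isClosed_setOf_mem_connectedComponentIn hF).preimage (Continuous.prodMk_right p)).isCompact,
    isConnected_connectedComponentIn_iff.2 hp⟩

open TopologicalSpace in
/-- If no point spreads over an open subset of `U`, then being joined by a nowhere dense
subcontinuum is a meagre relation on `U`. -/
theorem isMeagre_setOf_mem_meagerComposant [T2Space X] [CompactSpace X]
    [SecondCountableTopology X] {U : Set X} (hU : IsOpen U)
    (h : ∀ (p : X) (Q : Set X), IsOpen Q → Q.Nonempty → Q ⊆ U → ¬ SpreadsOver p Q) :
    IsMeagre ({q : X × X | q.2 ∈ meagerComposant q.1} ∩ U ×ˢ U) := by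
  let T : countableBasis X → Set (X × X) := fun B =>
    {q | q.2 ∈ connectedComponentIn ((B : Set X)ᶜ) q.1}
  let O : countableBasis X → Set (X × X) := fun B₀ =>
    ⋃ (B : countableBasis X) (_ : (B : Set X) ⊆ B₀), interior (T B)
  have hbasis := isBasis_countableBasis X
  have hBo : ∀ B : countableBasis X, IsOpen (B : Set X) := fun B => isOpen_of_mem_countableBasis B.2
  have hT : ∀ B, IsClosed (T B) := fun B =>
    isClosed_setOf_mem_connectedComponentIn (hBo B).isClosed_compl
  have hO : ∀ B, IsOpen (O B) := fun B =>
    isOpen_iUnion fun _ => isOpen_iUnion fun _ => isOpen_interior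
  have hsmall : ∀ V : Set X, IsOpen V → V.Nonempty →
      ∃ B : countableBasis X, (B : Set X) ⊆ V := by
    rintro V hV ⟨z, hz⟩
    obtain ⟨B, hB, -, hBV⟩ := hbasis.exists_subset_of_mem_open hz hV
    exact ⟨⟨B, hB⟩, hBV⟩
  have hND : IsNowhereDense ((⋂ B, O B) ∩ U ×ˢ U) := by
    by_contra hW
    obtain ⟨w, hw⟩ := nonempty_iff_ne_empty.2 hW
    obtain ⟨⟨a, b⟩, habW, habO, habU⟩ :=
      mem_closure_iff.1 (interior_subset hw) _ isOpen_interior hw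
    obtain ⟨P, Q, hP, hQ, haP, hbQ, hPQ⟩ := isOpen_prod_iff.1
      (isOpen_interior.inter (hU.prod hU)) a b ⟨habW, habU⟩
    have hQU : Q ⊆ U := fun q hq => (hPQ (mk_mem_prod haP hq)).2.2
    let G : countableBasis X × countableBasis X → Set X := fun i =>
      Prod.fst '' (O i.1 ∩ univ ×ˢ ((i.2 : Set X) ∩ Q))
    have hG : ∀ i, IsOpen (G i) := fun i =>
      isOpenMap_fst _ ((hO i.1).inter (isOpen_univ.prod ((hBo i.2).inter hQ)))
    -- Adding `(closure P)ᶜ` makes each set dense in all of `X`, so Baire's theorem applies without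
    -- passing to `P`.
    let D : {i : countableBasis X × countableBasis X // (i.2 : Set X) ⊆ Q} → Set X := fun i =>
      G i ∪ (closure P)ᶜ
    have hD : Dense (⋂ i, D i) := by
      refine dense_iInter_of_isOpen (fun i => (hG i).union isClosed_closure.isOpen_compl) ?_
      rintro ⟨⟨B, Q'⟩, hQ'⟩
      refine dense_iff_inter_open.2 fun V hV hVn => ?_
      by_cases hVP : (V ∩ P).Nonempty
      · obtain ⟨v, hvV, hvP⟩ := hVP
        obtain ⟨q, hq⟩ := nonempty_of_mem_countableBasis Q'.2
        have hcl : (v, q) ∈ closure ((⋂ B, O B) ∩ U ×ˢ U) :=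
          interior_subset (hPQ (mk_mem_prod hvP (hQ' hq))).1
        obtain ⟨⟨v', q'⟩, ⟨⟨hv', -⟩, hq'⟩, hO', -⟩ := mem_closure_iff.1 hcl
          ((V ∩ P) ×ˢ (Q' : Set X)) ((hV.inter hP).prod (hBo Q')) ⟨⟨hvV, hvP⟩, hq⟩
        exact ⟨v', hv', Or.inl ⟨(v', q'), ⟨mem_iInter.1 hO' B, mem_univ _, hq', hQ' hq'⟩, rfl⟩⟩
      · obtain ⟨v, hv⟩ := hVn
        refine ⟨v, hv, Or.inr fun hcl => hVP ?_⟩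
        exact mem_closure_iff.1 hcl V hV hv
    obtain ⟨p, hpP, hp⟩ := hD.inter_open_nonempty P hP ⟨a, haP⟩
    refine h p Q hQ ⟨b, hbQ⟩ hQU fun B Q' hB hBn hQ' hQn' hQQ' => ?_
    obtain ⟨B₀, hB₀⟩ := hsmall B hB hBn
    obtain ⟨Q₀, hQ₀⟩ := hsmall Q' hQ' hQn'
    obtain ⟨⟨p', q⟩, ⟨hpq, -, hqQ, -⟩, rfl⟩ :=
      (mem_iInter.1 hp ⟨(B₀, Q₀), hQ₀.trans hQQ'⟩).resolve_right fun hn => hn (subset_closure hpP)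
    simp only [O, mem_iUnion] at hpq
    obtain ⟨B₁, hB₁, hint⟩ := hpq
    have hq : q ∈ connectedComponentIn ((B₁ : Set X)ᶜ) p' :=
      (interior_subset hint : (p', q) ∈ T B₁)
    have hp' : p' ∈ (B₁ : Set X)ᶜ := connectedComponentIn_nonempty_iff.1 ⟨q, hq⟩
    refine ⟨connectedComponentIn ((B₁ : Set X)ᶜ) p',
      isSubcontinuum_connectedComponentIn (hBo B₁).isClosed_compl hp',
      mem_connectedComponentIn hp', fun hsub => ?_, q, ?_, hQ₀ hqQ⟩
    · obtain ⟨z, hz⟩ := nonempty_of_mem_countableBasis B₁.2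
      exact connectedComponentIn_subset _ _ (hsub (hB₀ (hB₁ hz))) hz
    · exact mem_interior.2 ⟨Prod.mk p' ⁻¹' interior (T B₁), fun z hz =>
        (interior_subset hz : (p', z) ∈ T B₁),
        isOpen_interior.preimage (Continuous.prodMk_right p'), hint⟩
  have hfr : IsMeagre (⋃ B, frontier (T B)) := by
    refine isMeagre_iUnion fun B => IsNowhereDense.isMeagre ?_
    rw [isClosed_frontier.isNowhereDense_iff, interior_frontier (hT B)]
  refine (hfr.union hND.isMeagre).mono ?_
  rintro ⟨p, q⟩ ⟨⟨L, ⟨hL, hLnd, hpL⟩, hqL⟩, hpqU⟩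
  by_cases hf : (p, q) ∈ ⋃ B, frontier (T B)
  · exact Or.inl hf
  refine Or.inr ⟨mem_iInter.2 fun B₀ => ?_, hpqU⟩
  -- A nowhere dense `L` covers no basic set, so some `B ⊆ B₀` avoids it and `L` lies in one
  -- component of `Bᶜ`.
  have hne : ((B₀ : Set X) \ L).Nonempty := by
    rw [sdiff_nonempty]
    intro hsub
    have hint := interior_maximal hsub (hBo B₀)
    rw [hL.1.isClosed.isNowhereDense_iff.1 hLnd] at hint
    obtain ⟨z, hz⟩ := nonempty_of_mem_countableBasis B₀.2
    exact hint hz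
  obtain ⟨B, hB⟩ := hsmall _ ((hBo B₀).sdiff hL.1.isClosed) hne
  have hpq : (p, q) ∈ T B :=
    hL.2.isPreconnected.subset_connectedComponentIn hpL (fun z hz hzB => (hB hzB).2 hz) hqL
  refine mem_iUnion₂.2 ⟨B, fun z hz => (hB hz).1, ?_⟩
  by_contra hint
  exact hf (mem_iUnion.2 ⟨B, subset_closure hpq, hint⟩)

end Meagre

/-! ### Mycielski's theorem via Baire category in `C(ℕ → Bool, X)`. -/

section Mycielski

theorem isOpenMap_prod_eval {ι X : Type*} [DecidableEq ι] [TopologicalSpace X] {i j : ι}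
    (hij : i ≠ j) : IsOpenMap fun w : ι → X => (w i, w j) := by
  refine IsOpenMap.of_sections fun w =>
    ⟨fun z => Function.update (Function.update w i z.1) j z.2, ?_, ?_, fun z => ?_⟩
  · exact ((continuous_const.update i continuous_fst).update j continuous_snd).continuousAt
  · simp
  · simp [hij]

theorem dense_setOf_pairwise_mem {ι X : Type*} [Finite ι] [MetricSpace X] [CompleteSpace X]
    {G : Set (X × X)} (hGo : IsOpen G) (hGd : Dense G) :
    Dense {w : ι → X | ∀ i j, i ≠ j → (w i, w j) ∈ G} := by
  classical
  have := Fintype.ofFinite ι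
  have hd : Dense (⋂ k : {k : ι × ι // k.1 ≠ k.2},
      {w : ι → X | (w k.1.1, w k.1.2) ∈ G}) :=
    dense_iInter_of_isOpen
      (fun k => hGo.preimage ((continuous_apply _).prodMk (continuous_apply _)))
      (fun k => hGd.preimage (isOpenMap_prod_eval k.2))
  refine hd.mono fun w hw i j hij => ?_
  exact mem_iInter.1 hw ⟨(i, j), hij⟩

theorem ContinuousMap.exists_forall_agree_dist_lt {X : Type*} [MetricSpace X]
    (f : C(ℕ → Bool, X)) {ε : ℝ} (hε : 0 < ε) :
    ∃ N : ℕ, ∀ a b : ℕ → Bool, (∀ i < N, a i = b i) → dist (f a) (f b) < ε := by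
  let _ : MetricSpace (ℕ → Bool) := PiNat.metricSpaceOfDiscreteUniformity fun _ => rfl
  have hf := CompactSpace.uniformContinuous_of_continuous f.continuous
  obtain ⟨δ, hδ, h⟩ := Metric.uniformContinuous_iff.1 hf ε hε
  obtain ⟨N, hN⟩ := exists_pow_lt_of_lt_one hδ (by norm_num : (1 / 2 : ℝ) < 1)
  refine ⟨N, fun a b hab => h (lt_of_le_of_lt ?_ hN)⟩
  exact PiNat.mem_cylinder_iff_dist_le.1 hab

/-- Fixing the coordinate `n` where the sequences differ makes the set of pairs clopen, hence
compact, unlike the full off-diagonal. -/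
theorem isOpen_setOf_apply_ne_imp {X : Type*} [TopologicalSpace X] {G : Set (X × X)}
    (hG : IsOpen G) (n : ℕ) :
    IsOpen {f : C(ℕ → Bool, X) | ∀ a b : ℕ → Bool, a n ≠ b n → (f a, f b) ∈ G} := by
  have hK : IsCompact {q : (ℕ → Bool) × (ℕ → Bool) | q.1 n ≠ q.2 n} := by
    have : IsClopen {q : (ℕ → Bool) × (ℕ → Bool) | q.1 n ≠ q.2 n} :=
      (isClopen_discrete {q : Bool × Bool | q.1 ≠ q.2}).preimage
        (f := fun q : (ℕ → Bool) × (ℕ → Bool) => (q.1 n, q.2 n)) (by fun_prop)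
    exact this.isClosed.isCompact
  have hc : Continuous fun f : C(ℕ → Bool, X) =>
      (f.comp ContinuousMap.fst).prodMk
        (f.comp (ContinuousMap.snd : C((ℕ → Bool) × (ℕ → Bool), ℕ → Bool))) := by
    refine ContinuousMap.continuous_of_continuous_uncurry _ ?_
    change Continuous fun p : C(ℕ → Bool, X) × ((ℕ → Bool) × (ℕ → Bool)) =>
      (p.1 p.2.1, p.1 p.2.2)
    fun_prop
  convert (ContinuousMap.isOpen_setOfPred_mapsTo hK hG).preimage hc using 1
  ext f
  exact ⟨fun h q hq => h q.1 q.2 hq, fun h a b hab => h (x := (a, b)) hab⟩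

theorem dense_setOf_apply_ne_imp {X : Type*} [MetricSpace X] [CompleteSpace X] {G : Set (X × X)}
    (hGo : IsOpen G) (hGd : Dense G) (n : ℕ) :
    Dense {f : C(ℕ → Bool, X) | ∀ a b : ℕ → Bool, a n ≠ b n → (f a, f b) ∈ G} := by
  refine Metric.dense_iff.2 fun f ε hε => ?_
  obtain ⟨N, hN⟩ := f.exists_forall_agree_dist_lt (half_pos (half_pos hε))
  -- `M ≥ N` keeps a map depending only on the first `M` coordinates close to `f`; `M > n` lets it
  -- see coordinate `n`.
  let M := max N (n + 1)
  let e : (Fin M → Bool) → ℕ → Bool := fun s i => if hi : i < M then s ⟨i, hi⟩ else false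
  obtain ⟨w, hwv, hw⟩ := Metric.dense_iff.1 (dense_setOf_pairwise_mem (ι := Fin M → Bool) hGo hGd)
    (fun s => f (e s)) _ (half_pos (half_pos hε))
  let r : C(ℕ → Bool, Fin M → Bool) := ⟨fun a i => a i, by fun_prop⟩
  let g : C(ℕ → Bool, X) := 
    ⟨fun a => w (r a), (continuous_of_discreteTopology (f := w)).comp r.continuous⟩
  refine ⟨g, ?_, fun a b hab => hw _ _ fun hr => hab ?_⟩
  · rw [Metric.mem_ball]
    refine lt_of_le_of_lt ((ContinuousMap.dist_le (half_pos hε).le).2 fun a => ?_) (half_lt_self hε)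
    have h₁ : dist (w (r a)) (f (e (r a))) < ε / 2 / 2 :=
      (dist_le_pi_dist w (fun s => f (e s)) (r a)).trans_lt hwv
    have h₂ : dist (f (e (r a))) (f a) < ε / 2 / 2 := by
      refine hN _ _ fun i hi => ?_
      have hiM : i < M := lt_of_lt_of_le hi (le_max_left _ _)
      simp [e, r, hiM]
    calc dist (w (r a)) (f a) ≤ _ := dist_triangle _ (f (e (r a))) _
      _ ≤ ε / 2 := by linarith
  · exact congrFun hr ⟨n, lt_of_lt_of_le n.lt_succ_self (le_max_right _ _)⟩

/-- **Mycielski's theorem** for binary relations: a meagre relation on a complete metric space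
admits a Cantor scheme of pairwise unrelated points in any nonempty open set. -/
theorem exists_continuous_pairwise_notMem_of_isMeagre {X : Type*} [MetricSpace X] [CompleteSpace X]
    {R : Set (X × X)} (hR : IsMeagre R) {U : Set X} (hU : IsOpen U) (hUn : U.Nonempty) :
    ∃ f : C(ℕ → Bool, X), (∀ a, f a ∈ U) ∧ ∀ a b, a ≠ b → (f a, f b) ∉ R := by
  obtain ⟨S, hSo, hSd, hSc, hSR⟩ := mem_residual_iff.1 hR
  have := hSc.to_subtype
  have hd : Dense (⋂ k : S × ℕ, {f : C(ℕ → Bool, X) |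
      ∀ a b : ℕ → Bool, a k.2 ≠ b k.2 → (f a, f b) ∈ (k.1 : Set (X × X))}) :=
    dense_iInter_of_isOpen (fun k => isOpen_setOf_apply_ne_imp (hSo _ k.1.2) _)
      (fun k => dense_setOf_apply_ne_imp (hSo _ k.1.2) (hSd _ k.1.2) _)
  obtain ⟨u, hu⟩ := hUn
  obtain ⟨f, hfU, hf⟩ := hd.inter_open_nonempty _ (ContinuousMap.isOpen_setOfPred_range_subset hU)
    ⟨ContinuousMap.const _ u, by rintro _ ⟨a, rfl⟩; exact hu⟩
  refine ⟨f, fun a => hfU (mem_range_self a), fun a b hab => ?_⟩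
  obtain ⟨n, hn⟩ := Function.ne_iff.1 hab
  exact hSR (mem_sInter.2 fun t ht => mem_iInter.1 hf (⟨t, ht⟩, n) a b hn)

end Mycielski

/-! ### Counting meager composants. -/

section MeagerComposants

theorem mem_meagerComposant_self {X : Type*} [TopologicalSpace X] [T1Space X] [ConnectedSpace X]
    [Nontrivial X] (x : X) : x ∈ meagerComposant x := by
  refine ⟨{x}, ⟨⟨isCompact_singleton, isConnected_singleton⟩, ?_, rfl⟩, rfl⟩
  rw [isClosed_singleton.isNowhereDense_iff, interior_singleton]

open TopologicalSpace in
theorem Cardinal.mk_le_two_power_aleph0_of_secondCountable (X : Type*) [TopologicalSpace X]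
    [T0Space X] [SecondCountableTopology X] : Cardinal.mk X ≤ 2 ^ Cardinal.aleph0 := by
  have hinj : Function.Injective fun x : X => {B : countableBasis X | x ∈ (B : Set X)} := by
    intro x y hxy
    exact (isBasis_countableBasis X).eq_iff.2 fun B hB =>
      Set.ext_iff.1 hxy (⟨B, hB⟩ : countableBasis X)
  refine (Cardinal.mk_le_of_injective hinj).trans ?_
  rw [Cardinal.mk_set]
  exact Cardinal.power_le_power_left two_ne_zero (Cardinal.mk_le_aleph0)

theorem Cardinal.mk_meagerComposants_le {X : Type*} [MetricSpace X] [CompactSpace X] :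
    Cardinal.mk (meagerComposants X) ≤ 2 ^ Cardinal.aleph0 := by
  have h : meagerComposants X = range (meagerComposant : X → Set X) := by
    ext M
    exact exists_congr fun x => eq_comm
  rw [h]
  exact Cardinal.mk_range_le.trans (Cardinal.mk_le_two_power_aleph0_of_secondCountable X)

end MeagerComposants

theorem theorem14 {X : Type*} [MetricSpace X] [CompactSpace X] [ConnectedSpace X]
    (hX : HereditarilyUnicoherent X) :
    Cardinal.mk (meagerComposants X) = 1 ∨
      Cardinal.mk (meagerComposants X) = 2 ^ Cardinal.aleph0 := by
  by_cases hone : ∀ x y : X, meagerComposant x = meagerComposant y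
  · left
    rw [Cardinal.mk_set_eq_one_iff]
    obtain ⟨x₀⟩ := (inferInstance : Nonempty X)
    refine ⟨meagerComposant x₀, subset_antisymm ?_ (singleton_subset_iff.2 ⟨x₀, rfl⟩)⟩
    rintro M ⟨x, rfl⟩
    exact hone x x₀
  right
  refine le_antisymm Cardinal.mk_meagerComposants_le ?_
  push Not at hone
  obtain ⟨x₀, y₀, hne⟩ := hone
  have : Nontrivial X := ⟨x₀, y₀, fun h => hne (h ▸ rfl)⟩
  obtain ⟨x, y, hxy⟩ : ∃ x y : X, y ∉ meagerComposant x := by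
    by_contra! hall
    exact hne ((eq_univ_of_forall (hall x₀)).trans (eq_univ_of_forall (hall y₀)).symm)
  have hK := hX.isSubcontinuum_joiningContinuum x y
  have hU : (interior (joiningContinuum x y)).Nonempty := by
    rw [nonempty_iff_ne_empty]
    intro hemp
    exact hxy ⟨_, ⟨hK, hK.1.isClosed.isNowhereDense_iff.2 hemp, mem_joiningContinuum_left x y⟩,
      mem_joiningContinuum_right x y⟩
  have hmeagre := isMeagre_setOf_mem_meagerComposant (isOpen_interior (s := joiningContinuum x y))
    fun p Q hQ hQn hQU => hX.not_spreadsOver_of_subset_joiningContinuum hQ hQn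
      (hQU.trans interior_subset) p
  obtain ⟨f, hfU, hf⟩ := exists_continuous_pairwise_notMem_of_isMeagre hmeagre isOpen_interior hU
  have hinj : Function.Injective fun a : ℕ → Bool =>
      (⟨meagerComposant (f a), f a, rfl⟩ : meagerComposants X) := by
    intro a b hab
    by_contra hn
    have heq : meagerComposant (f a) = meagerComposant (f b) := congrArg Subtype.val hab
    exact hf a b hn ⟨heq.symm.subset (mem_meagerComposant_self (f b)), hfU a, hfU b⟩
  simpa using Cardinal.lift_mk_le_lift_mk_of_injective hinj
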